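/- Let $d\in\mathbb N$ and let $M_d$ be the algebra of complex $d\times d$ matrices. A linear map $\Phi:M_d\to M_d$ is completely positive (CP) if $\mathrm{id}_k\otimes\Phi$ maps positive semidefinite matrices in $M_k\otimes M_d$ to positive semidefinite ones for every $k\ge 1$. A positive semidefinite $X\in M_k\otimes M_d$ is separable if $X=\sum_i A_i\otimes B_i$ is a finite sum with $A_i\in M_k$, $B_i\in M_d$ positive semidefinite. The map $\Phi$ is $k$-entanglement breaking ($k$-EB) if $\mathrm{id}_k\otimes\Phi$ preserves positive semidefiniteness and $(\mathrm{id}_k\otimes\Phi)(X)$ is separable for every positive semidefinite $X\in M_k\otimes M_d$; it is entanglement breaking (EB) if $(\mathrm{id}_k\otimes\Phi)(X)$ is separable for all $k\ge 1$ and all positive semidefinite $X\in M_k\otimes M_d$. The Schmidt rank of $\xi\in\mathbb C^d\otimes\mathbb C^d$ is the number of non-zero coefficients in a Schmidt decomposition of $\xi$. The Schmidt number $SN(\Phi)$ of a non-zero CP map $\Phi$ is the minimum, over all finite decompositions $C_\Phi=\sum_i|\xi_i\rangle\langle\xi_i|$ of the Choi matrix $C_\Phi=\sum_{i,j}E_{ij}\otimes\Phi(E_{ij})$,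 of the maximal Schmidt rank of the $\xi_i$; $SN(0)=1$. (1) Let $2\le n,m\le d$, and let $\Phi,\Psi:M_d\to M_d$ be CP maps such that $\Phi$ is $n$-EB and $\Psi$ is $m$-EB. Then $\Phi\circ\Psi$ is an $(n+m-1)$-EB CP map. (2) Let $k\ge 1$ and $2\le n_i\le d$ for $1\le i\le k$, and let $\Phi_i:M_d\to M_d$ be an $n_i$-EB CP map for each $i$. Then $\Phi_1\circ\Phi_2\circ\cdots\circ\Phi_k$ is an $\big(\sum_{i=1}^k n_i-k+1\big)$-EB CP map. (3) Let $2\le k\le d$ and let $\Phi:M_d\to M_d$ be a $k$-EB CP map. Then $\Phi^m$ is EB, where $m=\min\{SN(\Phi),\lceil\frac{d-1}{k-1}\rceil\}$. -/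

import Mathlib

open scoped ComplexOrder Kronecker

namespace EntanglementBreaking

/-- Complex `d × d` matrices. The tensor product `M_k ⊗ M_d` is identified, through the Kronecker
product, with the matrices indexed by `Fin k × Fin d`. -/
abbrev Mat (d : ℕ) : Type := Matrix (Fin d) (Fin d) ℂ

/-- Elements of `M_k ⊗ M_d = M_k(M_d)`. -/
abbrev BiMat (k d : ℕ) : Type := Matrix (Fin k × Fin d) (Fin k × Fin d) ℂ

/-- `id_k ⊗ Φ : M_k ⊗ M_{d₁} → M_k ⊗ M_{d₂}`: apply `Φ` to each of the `k × k` blocks. -/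
def idTensor (k : ℕ) {d₁ d₂ : ℕ} (Φ : Mat d₁ →ₗ[ℂ] Mat d₂) : BiMat k d₁ →ₗ[ℂ] BiMat k d₂ where
  toFun X := Matrix.of fun p q => Φ (Matrix.of fun a b => X (p.1, a) (q.1, b)) p.2 q.2
  map_add' X Y := by
    ext p q
    exact congrFun (congrFun (Φ.map_add (Matrix.of fun a b => X (p.1, a) (q.1, b))
      (Matrix.of fun a b => Y (p.1, a) (q.1, b))) p.2) q.2
  map_smul' c X := by
    ext p q
    exact congrFun (congrFun (Φ.map_smul c
      (Matrix.of fun a b => X (p.1, a) (q.1, b))) p.2) q.2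

theorem idTensor_kronecker (k : ℕ) {d₁ d₂ : ℕ} (Φ : Mat d₁ →ₗ[ℂ] Mat d₂) (A : Mat k)
    (B : Mat d₁) : idTensor k Φ (A ⊗ₖ B) = A ⊗ₖ Φ B := by
  ext p q
  exact congrFun (congrFun (Φ.map_smul (A p.1 q.1) B) p.2) q.2

/-- `X` is a finite sum of Kronecker products of positive semidefinite matrices. -/
def IsSeparable {k d : ℕ} (X : BiMat k d) : Prop :=
  ∃ (n : ℕ) (A : Fin n → Mat k) (B : Fin n → Mat d),
    (∀ i, (A i).PosSemidef) ∧ (∀ i, (B i).PosSemidef) ∧ X = ∑ i, A i ⊗ₖ B i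

/-- `Φ` is `k`-positive: `id_k ⊗ Φ` preserves positive semidefiniteness. -/
def IsKPositive (k : ℕ) {d₁ d₂ : ℕ} (Φ : Mat d₁ →ₗ[ℂ] Mat d₂) : Prop :=
  ∀ X : BiMat k d₁, X.PosSemidef → (idTensor k Φ X).PosSemidef

/-- `Φ` is completely positive. -/
def IsCP {d₁ d₂ : ℕ} (Φ : Mat d₁ →ₗ[ℂ] Mat d₂) : Prop :=
  ∀ k : ℕ, 1 ≤ k → IsKPositive k Φ

/-- `Φ` is `k`-entanglement breaking. -/
def IsKEB (k : ℕ) {d₁ d₂ : ℕ} (Φ : Mat d₁ →ₗ[ℂ] Mat d₂) : Prop :=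
  IsKPositive k Φ ∧ ∀ X : BiMat k d₁, X.PosSemidef → IsSeparable (idTensor k Φ X)

/-- `Φ` is entanglement breaking. -/
def IsEB {d₁ d₂ : ℕ} (Φ : Mat d₁ →ₗ[ℂ] Mat d₂) : Prop :=
  ∀ k : ℕ, 1 ≤ k → ∀ X : BiMat k d₁, X.PosSemidef → IsSeparable (idTensor k Φ X)

/-- The Choi matrix `C_Φ = (id ⊗ Φ)(∑ E_ij ⊗ E_ij)`. -/
def choi {d₁ d₂ : ℕ} (Φ : Mat d₁ →ₗ[ℂ] Mat d₂) : BiMat d₁ d₂ :=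
  idTensor d₁ Φ (∑ i : Fin d₁, ∑ j : Fin d₁, Matrix.single i j (1 : ℂ) ⊗ₖ Matrix.single i j (1 : ℂ))

/-- `ξ ∈ ℂ^{d₁} ⊗ ℂ^{d₂}` has a Schmidt decomposition `ξ = ∑ lam_i (u_i ⊗ v_i)` with exactly `r`
non-zero coefficients (the terms with a zero coefficient are left out). -/
def HasSchmidtDecomposition {d₁ d₂ : ℕ} (ξ : Fin d₁ × Fin d₂ → ℂ) (r : ℕ) : Prop :=
  ∃ (u : Fin r → EuclideanSpace ℂ (Fin d₁)) (v : Fin r → EuclideanSpace ℂ (Fin d₂))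
    (lam : Fin r → ℝ), Orthonormal ℂ u ∧ Orthonormal ℂ v ∧ (∀ i, 0 < lam i) ∧
      ∀ p : Fin d₁ × Fin d₂, ξ p = ∑ i, (lam i : ℂ) * (u i p.1 * v i p.2)

/-- The Schmidt rank: the number of non-zero coefficients in a Schmidt decomposition (the same
number for all of them). -/
noncomputable def schmidtRank {d₁ d₂ : ℕ} (ξ : Fin d₁ × Fin d₂ → ℂ) : ℕ :=
  sInf {r | HasSchmidtDecomposition ξ r}

/-- The Schmidt number of `X ≥ 0`: the minimum, over all decompositions `X = ∑ |ξ_i⟩⟨ξ_i|`, of the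
largest Schmidt rank of the `ξ_i`. The bound `1 ≤ r` matters for `X = 0` only: the Schmidt number
is `1` exactly for the separable matrices, among them `0`. -/
noncomputable def schmidtNumber {d₁ d₂ : ℕ} (X : BiMat d₁ d₂) : ℕ :=
  sInf {r | 1 ≤ r ∧ ∃ (n : ℕ) (ξ : Fin n → Fin d₁ × Fin d₂ → ℂ),
    X = ∑ i, Matrix.vecMulVec (ξ i) (star (ξ i)) ∧ ∀ i, schmidtRank (ξ i) ≤ r}

/-- The Schmidt number of a completely positive map is that of its Choi matrix. -/
noncomputable def mapSchmidtNumber {d₁ d₂ : ℕ} (Φ : Mat d₁ →ₗ[ℂ] Mat d₂) : ℕ :=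
  schmidtNumber (choi Φ)

end EntanglementBreaking

open EntanglementBreaking

/-! A vector of Schmidt rank at most `n` lies in a copy of ℂⁿ ⊗ ℂᵈ and local operators commute with
id ⊗ Φ, so an `n`-EB map makes every matrix of Schmidt number at most `n` separable
(`IsKEB.idTensor_mem_sepCone`).

For the composition, let Ψ be `m`-EB and apply it to a positive matrix with m + n - 1 block rows.
The output Y is positive and its corner of m rows is separable. Each product vector of the corner
lifts to a rank-one minorant of Y (`exists_lift_sum_vecMulVec`) and has at most n - 1 rows besides
its product part, hence Schmidt rank at most n. The remainder of Y vanishes on the corner and lives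
on the other n - 1 rows. So Y has Schmidt number at most n, and Φ makes it separable.

By iteration Φʲ is (j(n - 1) + 1)-EB. It is EB as soon as this number reaches either d or, after one
further application of Φ, the Schmidt number of Φ. -/

namespace EntanglementBreaking

open Matrix

/-! ### Rank-one minorants of positive semidefinite matrices -/

section PosSemidef

variable {ι κ : Type*} [Fintype ι] [Fintype κ]

theorem exists_eq_conjTranspose_mul_self {M : Matrix ι ι ℂ} (hM : M.PosSemidef) :
    ∃ B : Matrix ι ι ℂ, M = Bᴴ * B := by
  classical
  open scoped MatrixOrder in
  exact CStarAlgebra.nonneg_iff_eq_star_mul_self.mp hM.nonneg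

/-- A positive semidefinite matrix is a sum of rank-one positive semidefinite matrices. -/
theorem exists_eq_sum_vecMulVec {M : Matrix ι ι ℂ} (hM : M.PosSemidef) :
    ∃ ξ : ι → ι → ℂ, M = ∑ i, vecMulVec (ξ i) (star (ξ i)) := by
  obtain ⟨B, rfl⟩ := exists_eq_conjTranspose_mul_self hM
  refine ⟨fun i a => star (B i a), ?_⟩
  ext a b
  simp [Matrix.mul_apply, Matrix.sum_apply, vecMulVec_apply]

/-- On a kernel vector y of `M` the hypothesis reads 0 ≤ -|⟨φ, y⟩|², so φ ⟂ ker M, and (ker M)ᗮ is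
the range because `M` is Hermitian. -/
theorem mem_range_mulVec_of_posSemidef_sub {M : Matrix ι ι ℂ} (hM : M.PosSemidef) {φ : ι → ℂ}
    (h : (M - vecMulVec φ (star φ)).PosSemidef) : ∃ x, M *ᵥ x = φ := by
  classical
  set T : EuclideanSpace ℂ ι →ₗ[ℂ] EuclideanSpace ℂ ι := toEuclideanLin M with hT
  have hsymm : T.IsSymmetric := isSymmetric_toEuclideanLin_iff.mpr hM.isHermitian
  have hmem : WithLp.toLp 2 φ ∈ (LinearMap.range T)ᗮᗮ := by
    rw [hsymm.orthogonal_range]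
    intro y hy
    have hy0 : M *ᵥ y.ofLp = 0 := by
      have := congrArg WithLp.ofLp (LinearMap.mem_ker.mp hy)
      simpa [hT, toLpLin_apply] using this
    have h1 := h.dotProduct_mulVec_nonneg y.ofLp
    rw [sub_mulVec, hy0, zero_sub, vecMulVec_mulVec, dotProduct_neg, dotProduct_smul] at h1
    have h2 : star φ ⬝ᵥ y.ofLp = star (star y.ofLp ⬝ᵥ φ) :=
      star_dotProduct _ _
    rw [h2] at h1
    have h3 : star y.ofLp ⬝ᵥ φ = 0 := by
      have h4 := star_mul_self_nonneg (star y.ofLp ⬝ᵥ φ)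
      have h5 : star (star y.ofLp ⬝ᵥ φ) * (star y.ofLp ⬝ᵥ φ) = 0 := by
        refine le_antisymm ?_ h4
        simpa [mul_comm] using h1
      simpa using h5
    rw [EuclideanSpace.inner_eq_star_dotProduct, dotProduct_comm]
    exact h3
  rw [Submodule.orthogonal_orthogonal] at hmem
  obtain ⟨x, hx⟩ := hmem
  refine ⟨x.ofLp, ?_⟩
  have := congrArg WithLp.ofLp hx
  simpa [hT, toLpLin_apply] using this

theorem posSemidef_one_sub_vecMulVec [DecidableEq ι] {w : ι → ℂ} (hw : star w ⬝ᵥ w ≤ 1) :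
    (1 - vecMulVec w (star w)).PosSemidef := by
  refine .of_dotProduct_mulVec_nonneg
    (isHermitian_one.sub (posSemidef_vecMulVec_self_star w).isHermitian) fun x => ?_
  have hcs := norm_inner_le_norm (𝕜 := ℂ) (WithLp.toLp 2 w) (WithLp.toLp 2 x)
  have key : ∀ v : ι → ℂ, star v ⬝ᵥ v = ((‖WithLp.toLp 2 v‖ ^ 2 : ℝ) : ℂ) := by
    intro v
    have := inner_self_eq_norm_sq_to_K (𝕜 := ℂ) (WithLp.toLp 2 v)
    rw [EuclideanSpace.inner_eq_star_dotProduct, dotProduct_comm] at this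
    simpa using this
  have hin : inner ℂ (WithLp.toLp 2 w) (WithLp.toLp 2 x) = star w ⬝ᵥ x := by
    rw [EuclideanSpace.inner_eq_star_dotProduct, dotProduct_comm]
  rw [hin] at hcs
  rw [key w] at hw
  have hw' : ‖WithLp.toLp 2 w‖ ^ 2 ≤ 1 := by exact_mod_cast hw
  have h2 : star x ⬝ᵥ w = star (star w ⬝ᵥ x) :=
    star_dotProduct _ _
  have h3 : star w ⬝ᵥ x * star (star w ⬝ᵥ x) = ((‖star w ⬝ᵥ x‖ ^ 2 : ℝ) : ℂ) := by
    simpa using Complex.mul_conj' (star w ⬝ᵥ x)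
  rw [sub_mulVec, one_mulVec, vecMulVec_mulVec, dotProduct_sub, dotProduct_smul, h2, key x]
  have h4 : MulOpposite.op (star w ⬝ᵥ x) • star (star w ⬝ᵥ x)
      = ((‖star w ⬝ᵥ x‖ ^ 2 : ℝ) : ℂ) := by
    rw [← h3]; simp [mul_comm]
  rw [h4, ← Complex.ofReal_sub, Complex.zero_le_real, sub_nonneg]
  calc ‖star w ⬝ᵥ x‖ ^ 2 ≤ (‖WithLp.toLp 2 w‖ * ‖WithLp.toLp 2 x‖) ^ 2 := by gcongr
    _ = ‖WithLp.toLp 2 w‖ ^ 2 * ‖WithLp.toLp 2 x‖ ^ 2 := by ring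
    _ ≤ 1 * ‖WithLp.toLp 2 x‖ ^ 2 := by gcongr
    _ = _ := one_mul _

/-- A rank-one minorant of a submatrix lifts to a rank-one minorant of the whole matrix. -/
theorem exists_lift_vecMulVec {Y : Matrix ι ι ℂ} (hY : Y.PosSemidef) (f : κ → ι) {φ : κ → ℂ}
    (h : (Y.submatrix f f - vecMulVec φ (star φ)).PosSemidef) :
    ∃ ψ : ι → ℂ, ψ ∘ f = φ ∧ (Y - vecMulVec ψ (star ψ)).PosSemidef := by
  classical
  obtain ⟨x, hx⟩ := mem_range_mulVec_of_posSemidef_sub (hY.submatrix f) h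
  obtain ⟨B, rfl⟩ := exists_eq_conjTranspose_mul_self hY
  -- On the corner φ is B_f* w, so B* w is an extension of it.
  set w : ι → ℂ := B.submatrix id f *ᵥ x with hw
  have hφ : φ = (B.submatrix id f)ᴴ *ᵥ w := by
    rw [← hx, hw, mulVec_mulVec]
    rfl
  have hc : star w ⬝ᵥ w = star x ⬝ᵥ φ := by
    rw [hφ, dotProduct_mulVec (star x), ← star_mulVec]
  -- Testing the hypothesis on `x` gives ‖w‖² - ‖w‖⁴ ≥ 0.
  have hc1 : star w ⬝ᵥ w ≤ 1 := by
    have h0 : 0 ≤ star w ⬝ᵥ w := dotProduct_star_self_nonneg w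
    have h1 := h.dotProduct_mulVec_nonneg x
    rw [sub_mulVec, hx, vecMulVec_mulVec, dotProduct_sub, dotProduct_smul] at h1
    have h2 : star φ ⬝ᵥ x = star (star w ⬝ᵥ w) := by
      rw [hc, star_dotProduct]
    rw [h2, ← hc] at h1
    obtain ⟨r, hr⟩ : ∃ r : ℝ, star w ⬝ᵥ w = r := ⟨_, Complex.eq_re_of_ofReal_le h0⟩
    rw [hr] at h0 h1 ⊢
    have h0' : 0 ≤ r := by exact_mod_cast h0
    have h1' : r * r ≤ r := by
      have : (0:ℂ) ≤ ((r - r * r : ℝ) : ℂ) := by simpa using h1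
      have := Complex.zero_le_real.mp this
      linarith
    have : r ≤ 1 := by nlinarith
    exact_mod_cast this
  refine ⟨Bᴴ *ᵥ w, ?_, ?_⟩
  · rw [hφ]; rfl
  · have h5 : Bᴴ * B - vecMulVec (Bᴴ *ᵥ w) (star (Bᴴ *ᵥ w))
        = Bᴴ * (1 - vecMulVec w (star w)) * B := by
      rw [mul_sub, sub_mul, mul_one, mul_vecMulVec, vecMulVec_mul, star_mulVec,
        conjTranspose_conjTranspose]
    rw [h5]
    exact (posSemidef_one_sub_vecMulVec hc1).conjTranspose_mul_mul_same B

/-- The vectors are lifted one at a time: once a lift is subtracted, the corner of what is left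
still dominates the remaining sum. -/
theorem exists_lift_sum_vecMulVec {τ : Type*} (s : Finset τ) (f : κ → ι) (φ : τ → κ → ℂ) :
    ∀ {Y : Matrix ι ι ℂ}, Y.PosSemidef →
      (Y.submatrix f f - ∑ t ∈ s, vecMulVec (φ t) (star (φ t))).PosSemidef →
      ∃ ψ : τ → ι → ℂ, (∀ t ∈ s, ψ t ∘ f = φ t) ∧
        (Y - ∑ t ∈ s, vecMulVec (ψ t) (star (ψ t))).PosSemidef := by
  classical
  induction s using Finset.induction_on with
  | empty => intro Y hY _; exact ⟨fun _ => 0, by simp, by simpa using hY⟩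
  | insert a s ha ih =>
    intro Y hY h
    rw [Finset.sum_insert ha] at h
    have h1 : (Y.submatrix f f - vecMulVec (φ a) (star (φ a))).PosSemidef := by
      have h2 := h.add (posSemidef_sum s fun t _ => posSemidef_vecMulVec_self_star (φ t))
      convert h2 using 1
      abel
    obtain ⟨η, hη, hη'⟩ := exists_lift_vecMulVec hY f h1
    obtain ⟨ψ, hψ, hψ'⟩ := ih hη' (by
      convert h using 1
      rw [← hη, ← sub_sub]
      rfl)
    refine ⟨Function.update ψ a η, ?_, ?_⟩
    · intro t ht
      rcases Finset.mem_insert.mp ht with rfl | hts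
      · simpa using hη
      · rw [Function.update_of_ne (by rintro rfl; exact ha hts)]
        exact hψ t hts
    · rw [Finset.sum_insert ha, ← sub_sub]
      convert hψ' using 2
      · simp
      · refine Finset.sum_congr rfl fun t ht => ?_
        rw [Function.update_of_ne (by rintro rfl; exact ha ht)]

end PosSemidef

/-! ### Existence of Schmidt decompositions -/

/-- Ensures that the infimum in `schmidtRank` is attained and is not the default value 0 of an empty
set. -/
theorem HasSchmidtDecomposition.nonempty {d₁ d₂ : ℕ} (ξ : Fin d₁ × Fin d₂ → ℂ) :
    ∃ r, HasSchmidtDecomposition ξ r := by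
  classical
  let A : Matrix (Fin d₁) (Fin d₂) ℂ := of fun a b => ξ (a, b)
  have hM : (A * Aᴴ).PosSemidef := posSemidef_self_mul_conjTranspose A
  let u := hM.1.eigenvectorBasis
  let ev := hM.1.eigenvalues
  let w : Fin d₁ → EuclideanSpace ℂ (Fin d₂) := fun i => WithLp.toLp 2 (star (u i).ofLp ᵥ* A)
  -- The `u i` diagonalize A A*, which is what makes the vectors u_i* A pairwise orthogonal.
  have hw : ∀ i j, inner ℂ (w i) (w j) = if i = j then (ev i : ℂ) else 0 := by
    intro i j
    rw [EuclideanSpace.inner_eq_star_dotProduct]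
    have h1 : star (star (u i).ofLp ᵥ* A) = Aᴴ *ᵥ (u i).ofLp := by
      rw [star_vecMul, star_star]
    have h2 := hM.1.mulVec_eigenvectorBasis i
    have h3 := orthonormal_iff_ite.mp u.orthonormal j i
    rw [EuclideanSpace.inner_eq_star_dotProduct, dotProduct_comm] at h3
    change (star (u j).ofLp ᵥ* A) ⬝ᵥ star (star (u i).ofLp ᵥ* A) = _
    rw [h1, ← dotProduct_mulVec, mulVec_mulVec, h2]
    change star (u j).ofLp ⬝ᵥ (ev i • (u i).ofLp) = _
    rw [dotProduct_smul, h3]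
    by_cases h : i = j
    · simp [h]
    · simp [h, Ne.symm h]
  have hev : ∀ i, 0 ≤ ev i := hM.eigenvalues_nonneg
  have hw0 : ∀ i, ev i = 0 → w i = 0 := by
    intro i hi
    have := hw i i
    simpa [hi] using this
  have hξ : ∀ p : Fin d₁ × Fin d₂, ξ p = ∑ i, u i p.1 * w i p.2 := by
    rintro ⟨a, b⟩
    have h1 := u.sum_repr (WithLp.toLp 2 (fun a' => ξ (a', b)))
    have h2 := congrArg (fun z : EuclideanSpace ℂ (Fin d₁) => z a) h1
    simp only [WithLp.ofLp_sum, WithLp.ofLp_smul, Finset.sum_apply, Pi.smul_apply,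
      smul_eq_mul] at h2
    rw [← h2]
    refine Finset.sum_congr rfl fun i _ => ?_
    rw [mul_comm, u.repr_apply_apply, EuclideanSpace.inner_eq_star_dotProduct, dotProduct_comm]
    rfl
  let e := (Fintype.equivFin {i // ev i ≠ 0}).symm
  have hpos : ∀ i : {i // ev i ≠ 0}, 0 < Real.sqrt (ev i) := fun i =>
    Real.sqrt_pos.mpr ((hev i).lt_of_ne' i.2)
  refine ⟨_, fun i => u (e i), fun i => ((Real.sqrt (ev (e i)) : ℂ)⁻¹) • w (e i),
    fun i => Real.sqrt (ev (e i)), ?_, ?_, fun i => hpos _, ?_⟩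
  · exact u.orthonormal.comp _ (Subtype.val_injective.comp e.injective)
  · rw [orthonormal_iff_ite]
    intro i j
    rw [inner_smul_left, inner_smul_right, hw]
    by_cases h : i = j
    · subst h
      have h1 : ((Real.sqrt (ev (e i)) : ℝ) : ℂ) ≠ 0 := by exact_mod_cast (hpos (e i)).ne'
      have h2 : ((ev (e i) : ℝ) : ℂ) = (Real.sqrt (ev (e i)) : ℂ) * (Real.sqrt (ev (e i)) : ℂ) := by
        rw [← Complex.ofReal_mul, Real.mul_self_sqrt (hev _)]
      simp only [if_true, map_inv₀, Complex.conj_ofReal]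
      rw [h2]
      field_simp
    · have : (e i : Fin d₁) ≠ e j := fun h' => h (e.injective (Subtype.ext h'))
      simp [h, this]
  · intro p
    rw [hξ]
    have h1 : ∑ i, u i p.1 * w i p.2 = ∑ i : {i // ev i ≠ 0}, u i p.1 * w i p.2 := by
      rw [← Finset.sum_subtype (Finset.univ.filter fun i => ev i ≠ 0) (by simp)
        fun i => u i p.1 * w i p.2, Finset.sum_filter]
      · refine Finset.sum_congr rfl fun i _ => ?_
        split_ifs with h
        · rfl
        · simp [hw0 i (not_not.mp h)]
    rw [h1, ← e.sum_comp]
    refine Finset.sum_congr rfl fun i _ => ?_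
    have h1 : ((Real.sqrt (ev (e i)) : ℝ) : ℂ) ≠ 0 := by exact_mod_cast (hpos (e i)).ne'
    simp only [PiLp.smul_apply, smul_eq_mul]
    field_simp

/-! ### Local conjugations and the cones of bounded Schmidt number -/

variable {k l d d₁ d₂ : ℕ}

/-- The matrix `|ξ⟩⟨ξ|` of the vector `ξ` whose coefficient matrix is `M`. -/
def rankOne (M : Matrix (Fin k) (Fin d) ℂ) : BiMat k d :=
  vecMulVec (fun p => M p.1 p.2) (star fun p => M p.1 p.2)

theorem rankOne_apply (M : Matrix (Fin k) (Fin d) ℂ) (p q : Fin k × Fin d) :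
    rankOne M p q = M p.1 p.2 * star (M q.1 q.2) := rfl

theorem rankOne_of (ξ : Fin k × Fin d → ℂ) :
    rankOne (of fun a b => ξ (a, b)) = vecMulVec ξ (star ξ) := rfl

theorem posSemidef_rankOne (M : Matrix (Fin k) (Fin d) ℂ) : (rankOne M).PosSemidef :=
  posSemidef_vecMulVec_self_star _

/-- Conjugation of a bipartite matrix by `V ⊗ 1`. -/
def leftConj (V : Matrix (Fin l) (Fin k) ℂ) : BiMat k d →+ BiMat l d where
  toFun X := (V ⊗ₖ (1 : Mat d)) * X * (V ⊗ₖ (1 : Mat d))ᴴ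
  map_zero' := by simp
  map_add' X Y := by rw [Matrix.mul_add, Matrix.add_mul]

theorem leftConj_def (V : Matrix (Fin l) (Fin k) ℂ) (X : BiMat k d) :
    leftConj V X = (V ⊗ₖ (1 : Mat d)) * X * (V ⊗ₖ (1 : Mat d))ᴴ := rfl

theorem leftConj_apply (V : Matrix (Fin l) (Fin k) ℂ) (X : BiMat k d) (p q : Fin l × Fin d) :
    leftConj V X p q = ∑ s, ∑ t, (V p.1 s * star (V q.1 t)) * X (s, p.2) (t, q.2) := by
  simp only [leftConj_def, Matrix.mul_apply, Fintype.sum_prod_type, kroneckerMap_apply,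
    conjTranspose_apply, one_apply, mul_ite, mul_one, mul_zero, ite_mul, zero_mul,
    Finset.sum_ite_eq, Finset.mem_univ, if_true, apply_ite star, star_zero]
  simp only [Finset.sum_mul]
  rw [Finset.sum_comm]
  refine Finset.sum_congr rfl fun s _ => Finset.sum_congr rfl fun t _ => ?_
  ring

theorem leftConj_kronecker (V : Matrix (Fin l) (Fin k) ℂ) (A : Mat k) (B : Mat d) :
    leftConj V (A ⊗ₖ B) = (V * A * Vᴴ) ⊗ₖ B := by
  rw [leftConj_def, conjTranspose_kronecker, ← mul_kronecker_mul, ← mul_kronecker_mul]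
  simp

theorem leftConj_rankOne (V : Matrix (Fin l) (Fin k) ℂ) (M : Matrix (Fin k) (Fin d) ℂ) :
    leftConj V (rankOne M) = rankOne (V * M) := by
  ext p q
  simp only [leftConj_apply, rankOne_apply, Matrix.mul_apply, star_sum, star_mul',
    Finset.sum_mul_sum]
  refine Finset.sum_congr rfl fun s _ => Finset.sum_congr rfl fun t _ => ?_
  ring

theorem idTensor_leftConj (Φ : Mat d₁ →ₗ[ℂ] Mat d₂) (V : Matrix (Fin l) (Fin k) ℂ)
    (X : BiMat k d₁) : idTensor l Φ (leftConj V X) = leftConj V (idTensor k Φ X) := by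
  ext p q
  rw [leftConj_apply]
  have h : (of fun a b => leftConj V X (p.1, a) (q.1, b)) =
      ∑ s, ∑ t, (V p.1 s * star (V q.1 t)) • (of fun a b => X (s, a) (t, b) : Mat d₁) := by
    ext a b
    simp [leftConj_apply, Matrix.sum_apply]
  change Φ (of fun a b => leftConj V X (p.1, a) (q.1, b)) p.2 q.2 = _
  rw [h]
  simp only [map_sum, map_smul, Matrix.sum_apply, Matrix.smul_apply, smul_eq_mul]
  rfl

theorem idTensor_comp (Φ Ψ : Mat d →ₗ[ℂ] Mat d) (X : BiMat k d) :
    idTensor k (Φ ∘ₗ Ψ) X = idTensor k Φ (idTensor k Ψ X) := rfl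

/-- The cone of separable matrices. -/
def sepCone (k d : ℕ) : AddSubmonoid (BiMat k d) :=
  AddSubmonoid.closure {X | ∃ (A : Mat k) (B : Mat d), A.PosSemidef ∧ B.PosSemidef ∧ X = A ⊗ₖ B}

/-- The cone of positive semidefinite matrices of Schmidt number at most `r`. -/
def schmidtCone (r k d : ℕ) : AddSubmonoid (BiMat k d) :=
  AddSubmonoid.closure {X | ∃ (V : Matrix (Fin k) (Fin r) ℂ) (W : Matrix (Fin r) (Fin d) ℂ),
    X = rankOne (V * W)}

theorem mem_sepCone {X : BiMat k d} : X ∈ sepCone k d ↔ IsSeparable X := by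
  constructor
  · intro h
    induction h using AddSubmonoid.closure_induction with
    | mem X h =>
      obtain ⟨A, B, hA, hB, rfl⟩ := h
      exact ⟨1, fun _ => A, fun _ => B, fun _ => hA, fun _ => hB, by simp⟩
    | zero => exact ⟨0, fun _ => 0, fun _ => 0, fun i => i.elim0, fun i => i.elim0, by simp⟩
    | add X Y _ _ hX hY =>
      obtain ⟨n, A, B, hA, hB, rfl⟩ := hX
      obtain ⟨n', A', B', hA', hB', rfl⟩ := hY
      refine ⟨n + n', Fin.append A A', Fin.append B B', ?_, ?_, ?_⟩
      · intro i
        refine Fin.addCases (fun i => ?_) (fun i => ?_) i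
        · simpa using hA i
        · simpa using hA' i
      · intro i
        refine Fin.addCases (fun i => ?_) (fun i => ?_) i
        · simpa using hB i
        · simpa using hB' i
      · simp [Fin.sum_univ_add]
  · rintro ⟨n, A, B, hA, hB, rfl⟩
    exact sum_mem fun i _ => AddSubmonoid.subset_closure ⟨A i, B i, hA i, hB i, rfl⟩

theorem leftConj_mem_sepCone (V : Matrix (Fin l) (Fin k) ℂ) {X : BiMat k d}
    (hX : X ∈ sepCone k d) : leftConj V X ∈ sepCone l d := by
  have : sepCone k d ≤ (sepCone l d).comap (leftConj V) := by
    refine (AddSubmonoid.closure_le).mpr ?_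
    rintro _ ⟨A, B, hA, hB, rfl⟩
    exact AddSubmonoid.subset_closure
      ⟨_, B, hA.mul_mul_conjTranspose_same V, hB, leftConj_kronecker V A B⟩
  exact this hX

theorem leftConj_mem_schmidtCone {r : ℕ} (V : Matrix (Fin l) (Fin k) ℂ) {X : BiMat k d}
    (hX : X ∈ schmidtCone r k d) : leftConj V X ∈ schmidtCone r l d := by
  have : schmidtCone r k d ≤ (schmidtCone r l d).comap (leftConj V) := by
    refine (AddSubmonoid.closure_le).mpr ?_
    rintro _ ⟨U, W, rfl⟩
    exact AddSubmonoid.subset_closure ⟨V * U, W, by rw [leftConj_rankOne, Matrix.mul_assoc]⟩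
  exact this hX

theorem schmidtCone_mono {r r' : ℕ} (h : r ≤ r') : schmidtCone r k d ≤ schmidtCone r' k d := by
  obtain ⟨t, rfl⟩ := Nat.exists_eq_add_of_le h
  refine AddSubmonoid.closure_mono ?_
  rintro _ ⟨V, W, rfl⟩
  -- Pad the two factors with zero columns and zero rows.
  refine ⟨of fun p => Fin.append (V p) 0, of (Fin.append (fun i => W i) 0), ?_⟩
  congr 1
  ext a b
  simp [Matrix.mul_apply, Fin.sum_univ_add]

theorem PosSemidef.mem_schmidtCone {X : BiMat k d} (hX : X.PosSemidef) :
    X ∈ schmidtCone d k d := by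
  obtain ⟨ξ, rfl⟩ := exists_eq_sum_vecMulVec hX
  refine sum_mem fun i _ => AddSubmonoid.subset_closure ⟨of fun a b => ξ i (a, b), 1, ?_⟩
  rw [Matrix.mul_one, rankOne_of]

/-- An `n`-entanglement breaking map turns matrices of Schmidt number at most `n` into separable
ones. -/
theorem IsKEB.idTensor_mem_sepCone {n : ℕ} {Φ : Mat d₁ →ₗ[ℂ] Mat d₂} (hΦ : IsKEB n Φ)
    {X : BiMat k d₁} (hX : X ∈ schmidtCone n k d₁) : idTensor k Φ X ∈ sepCone k d₂ := by
  have : schmidtCone n k d₁ ≤ (sepCone k d₂).comap (idTensor k Φ) := by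
    refine (AddSubmonoid.closure_le).mpr ?_
    rintro _ ⟨V, W, rfl⟩
    change idTensor k Φ (rankOne (V * W)) ∈ sepCone k d₂
    rw [← leftConj_rankOne, idTensor_leftConj]
    exact leftConj_mem_sepCone V (mem_sepCone.mpr (hΦ.2 _ (posSemidef_rankOne W)))
  exact this hX

/-! ### Matrices with a separable corner -/

theorem IsSeparable.exists_eq_sum_vecMulVec {X : BiMat k d} (hX : IsSeparable X) :
    ∃ (n : ℕ) (a : Fin n → Fin k → ℂ) (b : Fin n → Fin d → ℂ),
      X = ∑ i, vecMulVec (fun p : Fin k × Fin d => a i p.1 * b i p.2)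
        (star fun p : Fin k × Fin d => a i p.1 * b i p.2) := by
  obtain ⟨n, A, B, hA, hB, rfl⟩ := hX
  choose a ha using fun i => EntanglementBreaking.exists_eq_sum_vecMulVec (hA i)
  choose b hb using fun i => EntanglementBreaking.exists_eq_sum_vecMulVec (hB i)
  let e := (Fintype.equivFin (Fin n × Fin k × Fin d)).symm
  refine ⟨_, fun i => a (e i).1 (e i).2.1, fun i => b (e i).1 (e i).2.2, ?_⟩
  rw [e.sum_comp fun t => vecMulVec (fun p : Fin k × Fin d => a t.1 t.2.1 p.1 * b t.1 t.2.2 p.2)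
        (star fun p : Fin k × Fin d => a t.1 t.2.1 p.1 * b t.1 t.2.2 p.2)]
  rw [Fintype.sum_prod_type]
  refine Finset.sum_congr rfl fun i _ => ?_
  rw [Fintype.sum_prod_type]
  conv_lhs => rw [ha i, hb i]
  ext p q
  simp only [kroneckerMap_apply, Matrix.sum_apply, vecMulVec_apply, Pi.star_apply, star_mul',
    Finset.sum_mul_sum]
  refine Finset.sum_congr rfl fun s _ => Finset.sum_congr rfl fun t _ => ?_
  ring

/-- A vector whose first `m` rows form a product vector has Schmidt rank at most `t + 1`. -/
theorem vecMulVec_mem_schmidtCone {m t : ℕ} {ψ : Fin (m + t) × Fin d → ℂ} {a : Fin m → ℂ}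
    {b : Fin d → ℂ} (h : ∀ i j, ψ (Fin.castAdd t i, j) = a i * b j) :
    vecMulVec ψ (star ψ) ∈ schmidtCone (t + 1) (m + t) d := by
  refine AddSubmonoid.subset_closure
    -- Inner index 0 carries the common row `b` of the corner; index j + 1 carries row m + j
    -- unchanged.
    ⟨of (Fin.append (fun i => Fin.cons (a i) 0) (fun j => Fin.cons 0 (Pi.single j 1))),
      of (Fin.cons b fun j c => ψ (Fin.natAdd m j, c)), ?_⟩
  rw [← rankOne_of]
  congr 1
  ext p c
  refine Fin.addCases (fun i => ?_) (fun j => ?_) p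
  · simp [Matrix.mul_apply, Fin.sum_univ_succ, h]
  · simp [Matrix.mul_apply, Fin.sum_univ_succ, Pi.single_apply]

/-- A positive semidefinite matrix with a separable corner of size `m` has Schmidt number at most
one more than the number of the remaining rows. -/
theorem mem_schmidtCone_of_isSeparable_submatrix {m t : ℕ} {Y : BiMat (m + t) d}
    (hY : Y.PosSemidef)
    (h : IsSeparable (Y.submatrix (Prod.map (Fin.castAdd t) id) (Prod.map (Fin.castAdd t) id) :
      BiMat m d)) :
    Y ∈ schmidtCone (t + 1) (m + t) d := by
  obtain ⟨n, a, b, hab⟩ := h.exists_eq_sum_vecMulVec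
  obtain ⟨ψ, hψ, hR⟩ := exists_lift_sum_vecMulVec Finset.univ (Prod.map (Fin.castAdd t) id)
    (fun i (p : Fin m × Fin d) => a i p.1 * b i p.2) hY (by rw [hab, sub_self]; exact .zero)
  obtain ⟨χ, hχ⟩ := EntanglementBreaking.exists_eq_sum_vecMulVec hR
  -- The lifts exhaust the corner, so the diagonal of the remainder, a sum of |χ|², is zero there.
  have hχ0 : ∀ s i j, χ s (Fin.castAdd t i, j) = 0 := by
    intro s i j
    have h1 := congrFun (congrFun hab (i, j)) (i, j)
    have h2 := congrFun (congrFun hχ (Fin.castAdd t i, j)) (Fin.castAdd t i, j)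
    have h3 : ∀ x, ψ x (Fin.castAdd t i, j) = a x i * b x j := fun x =>
      congrFun (hψ x (Finset.mem_univ x)) (i, j)
    simp only [Matrix.sub_apply, Matrix.sum_apply, vecMulVec_apply, Pi.star_apply,
      submatrix_apply, Prod.map_apply, id_eq, h3] at h1 h2
    rw [h1, sub_self] at h2
    have h4 := (Finset.sum_eq_zero_iff_of_nonneg fun x _ => mul_star_self_nonneg
      (χ x (Fin.castAdd t i, j))).mp h2.symm s (Finset.mem_univ s)
    simpa using h4
  rw [← sub_add_cancel Y (∑ i, vecMulVec (ψ i) (star (ψ i))), hχ]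
  refine add_mem (sum_mem fun s _ => ?_) (sum_mem fun i _ => ?_)
  · exact vecMulVec_mem_schmidtCone (a := 0) (b := 0) (by simpa using hχ0 s)
  · exact vecMulVec_mem_schmidtCone fun x j => congrFun (hψ i (Finset.mem_univ i)) (x, j)

/-! ### Composition of entanglement breaking maps -/

theorem IsCP.comp {Φ Ψ : Mat d →ₗ[ℂ] Mat d} (hΦ : IsCP Φ) (hΨ : IsCP Ψ) : IsCP (Φ ∘ₗ Ψ) :=
  fun k hk X hX => hΦ k hk _ (hΨ k hk X hX)

theorem IsKEB.comp {n m : ℕ} (hn : 1 ≤ n) (hm : 1 ≤ m) {Φ Ψ : Mat d →ₗ[ℂ] Mat d}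
    (hΦ : IsCP Φ) (hΦn : IsKEB n Φ) (hΨ : IsCP Ψ) (hΨm : IsKEB m Ψ) :
    IsKEB (n + m - 1) (Φ ∘ₗ Ψ) := by
  refine ⟨(hΦ.comp hΨ) _ (by omega), ?_⟩
  obtain ⟨t, rfl⟩ := Nat.exists_eq_add_of_le' hn
  rw [show t + 1 + m - 1 = m + t by omega]
  intro X hX
  rw [idTensor_comp, ← mem_sepCone]
  refine hΦn.idTensor_mem_sepCone
    (mem_schmidtCone_of_isSeparable_submatrix (hΨ _ (by omega) X hX) ?_)
  -- The corner of the image is the image of the corner, by definition of `idTensor`.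
  exact hΨm.2 _ (hX.submatrix (Prod.map (Fin.castAdd t) id))

/-- The empty product: 1 is neutral for (n, m) ↦ n + m - 1. -/
theorem isKEB_one_id : IsKEB 1 (LinearMap.id : Mat d →ₗ[ℂ] Mat d) := by
  refine ⟨fun X hX => hX, fun X hX => ?_⟩
  refine ⟨1, fun _ => 1, fun _ => X.submatrix (Prod.mk 0) (Prod.mk 0), fun _ => .one,
    fun _ => hX.submatrix _, ?_⟩
  ext ⟨i, a⟩ ⟨j, b⟩
  obtain rfl := Subsingleton.elim i 0
  obtain rfl := Subsingleton.elim j 0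
  simp [idTensor]

theorem isKEB_prod_ofFn (k : ℕ) : ∀ (n : Fin k → ℕ) (Φ : Fin k → Module.End ℂ (Mat d)),
    (∀ i, 1 ≤ n i) → (∀ i, IsCP (Φ i) ∧ IsKEB (n i) (Φ i)) →
      IsCP (List.ofFn Φ).prod ∧ IsKEB ((∑ i, n i) - k + 1) (List.ofFn Φ).prod := by
  induction k with
  | zero =>
    intro n Φ _ _
    simp only [List.ofFn_zero, List.prod_nil, Finset.univ_eq_empty, Finset.sum_empty]
    exact ⟨fun k _ X hX => hX, isKEB_one_id⟩
  | succ k ih =>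
    intro n Φ hn hΦ
    obtain ⟨h1, h2⟩ := ih (fun i => n i.succ) (fun i => Φ i.succ) (fun i => hn _) fun i => hΦ _
    rw [List.ofFn_succ, List.prod_cons, Fin.sum_univ_succ]
    -- Makes the truncated subtractions below exact.
    have hsum : k ≤ ∑ i : Fin k, n i.succ := by
      simpa using Finset.card_nsmul_le_sum Finset.univ (fun i : Fin k => n i.succ) 1
        fun i _ => hn i.succ
    have hn0 := hn 0
    refine ⟨(hΦ 0).1.comp h1, ?_⟩
    rw [show n 0 + ∑ i : Fin k, n i.succ - (k + 1) + 1
      = n 0 + ((∑ i : Fin k, n i.succ) - k + 1) - 1 by omega]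
    exact IsKEB.comp hn0 (by omega) (hΦ 0).1 (hΦ 0).2 h1 h2

theorem IsKEB.pow {n : ℕ} (hn : 1 ≤ n) {Φ : Module.End ℂ (Mat d)} (hΦ : IsCP Φ)
    (hΦn : IsKEB n Φ) (j : ℕ) : IsKEB (j * n - j + 1) (Φ ^ j) := by
  simpa [List.ofFn_const] using
    (isKEB_prod_ofFn j (fun _ => n) (fun _ => Φ) (fun _ => hn) fun _ => ⟨hΦ, hΦn⟩).2

/-- A vector in ℂᵏ ⊗ ℂᵈ never has Schmidt rank above d. -/
theorem IsKEB.isEB {n : ℕ} (hdn : d ≤ n) {Φ : Mat d →ₗ[ℂ] Mat d} (hΦ : IsKEB n Φ) : IsEB Φ :=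
  fun _ _ _ hX => mem_sepCone.mp
    (hΦ.idTensor_mem_sepCone (schmidtCone_mono hdn (PosSemidef.mem_schmidtCone hX)))

/-! ### The Choi matrix and the Schmidt number -/

theorem choi_eq (Φ : Mat d →ₗ[ℂ] Mat d) : choi Φ = idTensor d Φ (rankOne 1) := by
  rw [choi]
  congr 1
  ext p q
  simp [Matrix.sum_apply, rankOne_apply, Matrix.single_apply, Matrix.one_apply, ite_and,
    eq_comm (a := p.2), eq_comm (a := q.2)]
  split_ifs <;> rfl

theorem vecMulVec_mem_schmidtCone_of_schmidtRank_le {r : ℕ} {ξ : Fin k × Fin d → ℂ}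
    (h : schmidtRank ξ ≤ r) : vecMulVec ξ (star ξ) ∈ schmidtCone r k d := by
  refine schmidtCone_mono h ?_
  obtain ⟨u, v, lam, -, -, -, hξ⟩ := Nat.sInf_mem (HasSchmidtDecomposition.nonempty ξ)
  refine AddSubmonoid.subset_closure
    ⟨of fun a i => u i a, of fun i b => (lam i : ℂ) * v i b, ?_⟩
  rw [← rankOne_of]
  congr 1
  ext a b
  rw [Matrix.mul_apply, of_apply, hξ]
  refine Finset.sum_congr rfl fun i _ => ?_
  change (lam i : ℂ) * (u i a * v i b) = u i a * (lam i * v i b)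
  ring

theorem schmidtNumber_spec {X : BiMat k d} (hX : X.PosSemidef) :
    1 ≤ schmidtNumber X ∧ X ∈ schmidtCone (schmidtNumber X) k d := by
  have hne : {r | 1 ≤ r ∧ ∃ (n : ℕ) (ξ : Fin n → Fin k × Fin d → ℂ),
      X = ∑ i, vecMulVec (ξ i) (star (ξ i)) ∧ ∀ i, schmidtRank (ξ i) ≤ r}.Nonempty := by
    obtain ⟨ξ, hξ⟩ := exists_eq_sum_vecMulVec hX
    let e := (Fintype.equivFin (Fin k × Fin d)).symm
    refine ⟨1 + ∑ i, schmidtRank (ξ (e i)), by omega, _, fun i => ξ (e i), ?_, fun i => ?_⟩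
    · rw [hξ, ← e.sum_comp]
    · exact (Finset.single_le_sum (f := fun i => schmidtRank (ξ (e i)))
        (fun _ _ => Nat.zero_le _) (Finset.mem_univ i)).trans (by omega)
  obtain ⟨h1, n, ξ, h2, h3⟩ := Nat.sInf_mem hne
  refine ⟨h1, ?_⟩
  have h4 : ∑ i, vecMulVec (ξ i) (star (ξ i)) ∈ schmidtCone (schmidtNumber X) k d :=
    sum_mem fun i _ => vecMulVec_mem_schmidtCone_of_schmidtRank_le (h3 i)
  rwa [← h2] at h4

/-- The vector with coefficient matrix M is M ⊗ 1 applied to the one with coefficient matrix 1, so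
the image of its projector is a local conjugate of the Choi matrix. -/
theorem idTensor_mem_schmidtCone_of_choi {r : ℕ} {Φ : Mat d →ₗ[ℂ] Mat d}
    (h : choi Φ ∈ schmidtCone r d d) {X : BiMat k d} (hX : X.PosSemidef) :
    idTensor k Φ X ∈ schmidtCone r k d := by
  obtain ⟨ξ, rfl⟩ := exists_eq_sum_vecMulVec hX
  rw [map_sum]
  refine sum_mem fun i _ => ?_
  rw [← rankOne_of, ← Matrix.mul_one (of fun a b => ξ i (a, b)), ← leftConj_rankOne,
    idTensor_leftConj, ← choi_eq]
  exact leftConj_mem_schmidtCone _ h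

theorem isEB_pow_mapSchmidtNumber {n : ℕ} (hn : 2 ≤ n) (hd : 1 ≤ d) {Φ : Module.End ℂ (Mat d)}
    (hΦ : IsCP Φ) (hΦn : IsKEB n Φ) : IsEB (Φ ^ mapSchmidtNumber Φ) := by
  have hpsd : (choi Φ).PosSemidef := by
    rw [choi_eq]
    exact hΦ d hd _ (posSemidef_rankOne 1)
  obtain ⟨h1, h2⟩ := schmidtNumber_spec hpsd
  change 1 ≤ mapSchmidtNumber Φ at h1
  change choi Φ ∈ schmidtCone (mapSchmidtNumber Φ) d d at h2
  obtain ⟨s, hs⟩ := Nat.exists_eq_add_of_le' h1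
  rw [hs] at h2 ⊢
  intro k _ X hX
  rw [pow_succ, ← mem_sepCone]
  change idTensor k (Φ ^ s) (idTensor k Φ X) ∈ _
  refine (IsKEB.pow (by omega) hΦ hΦn s).idTensor_mem_sepCone
    (schmidtCone_mono ?_ (idTensor_mem_schmidtCone_of_choi h2 hX))
  -- With Schmidt number s + 1, the innermost Φ leaves rank at most s + 1 ≤ s(n - 1) + 1 for Φˢ to
  -- break.
  have : s * 2 ≤ s * n := Nat.mul_le_mul_left s hn
  omega

theorem isEB_pow_ceil {n : ℕ} (hn : 2 ≤ n) {Φ : Module.End ℂ (Mat d)}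
    (hΦ : IsCP Φ) (hΦn : IsKEB n Φ) : IsEB (Φ ^ ⌈((d : ℚ) - 1) / ((n : ℚ) - 1)⌉₊) := by
  refine (IsKEB.pow (by omega) hΦ hΦn _).isEB ?_
  have h := Nat.le_ceil (((d : ℚ) - 1) / ((n : ℚ) - 1))
  set N := ⌈((d : ℚ) - 1) / ((n : ℚ) - 1)⌉₊
  have hn' : (2 : ℚ) ≤ n := by exact_mod_cast hn
  rw [div_le_iff₀ (by linarith)] at h
  -- That is, N(n - 1) + 1 ≥ d, written without subtraction.
  have h' : d + N ≤ N * n + 1 := by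
    have : (d : ℚ) + N ≤ N * n + 1 := by linarith
    exact_mod_cast this
  omega

end EntanglementBreaking

theorem mainTheorem7 (d : ℕ) :
    (∀ (n m : ℕ), 2 ≤ n → n ≤ d → 2 ≤ m → m ≤ d →
      ∀ Φ Ψ : Mat d →ₗ[ℂ] Mat d, IsCP Φ → IsKEB n Φ → IsCP Ψ → IsKEB m Ψ →
        IsCP (Φ ∘ₗ Ψ) ∧ IsKEB (n + m - 1) (Φ ∘ₗ Ψ)) ∧
    (∀ (k : ℕ), 1 ≤ k → ∀ (n : Fin k → ℕ) (Φ : Fin k → Module.End ℂ (Mat d)),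
      (∀ i, 2 ≤ n i ∧ n i ≤ d) → (∀ i, IsCP (Φ i) ∧ IsKEB (n i) (Φ i)) →
        IsCP (List.ofFn Φ).prod ∧ IsKEB ((∑ i, n i) - k + 1) (List.ofFn Φ).prod) ∧
    (∀ (k : ℕ), 2 ≤ k → k ≤ d →
      ∀ Φ : Module.End ℂ (Mat d), IsCP Φ → IsKEB k Φ →
        IsEB (Φ ^ min (mapSchmidtNumber Φ) ⌈((d : ℚ) - 1) / ((k : ℚ) - 1)⌉₊)) := by
  refine ⟨?_, ?_, ?_⟩
  · intro n m hn _ hm _ Φ Ψ hΦ hΦn hΨ hΨm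
    exact ⟨hΦ.comp hΨ, IsKEB.comp (by omega) (by omega) hΦ hΦn hΨ hΨm⟩
  · intro k _ n Φ hn hΦ
    exact isKEB_prod_ofFn k n Φ (fun i => by have := (hn i).1; omega) hΦ
  · intro k hk hkd Φ hΦ hΦk
    rcases min_choice (mapSchmidtNumber Φ) ⌈((d : ℚ) - 1) / ((k : ℚ) - 1)⌉₊ with h | h <;> rw [h]
    · exact isEB_pow_mapSchmidtNumber hk (by omega) hΦ hΦk
    · exact isEB_pow_ceil hk hΦ hΦk
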